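/- Throughout, $n\ge 1$, $\mathbb R^n$ carries the max norm and $B_r(x)=\{y:\|x-y\|_\infty\le r\}$. Let $\mathcal X\subset\mathbb R^n$ be a bounded measurable set, and let the system $x^+=T(x)$, $T:\mathbb R^n\to\mathbb R^n$, satisfy $\|T(p)-T(q)\|_\infty\le L\|p-q\|_\infty$ for all $p,q\in\mathcal X$, where $L>0$. A set $O$ is positively invariant (PI) if $T^k(x_0)\in O$ for all $x_0\in O$ and $k\ge 0$. A C-set is a convex compact set with the origin in its interior; its Minkowski function is $\psi_S(x)=\inf\{\mu\ge 0: x\in\mu S\}$. For $0\le\lambda<1$, a C-set $S$ is $\lambda$-contractive if $\psi_S(T(x))\le\lambda$ for every $x\in S$. **Trees.** Let $\mathcal D=\{(x_j,x_j^+)\}_{j=1}^M$ with $x_j\in\mathcal X$, $x_j^+=T(x_j)$. A tree $\mathcal Q$ is a finite list of nodes $i$, some of them leaves, each carrying a target radius $\hat r_i>0$ and target center $\hat x_i$ with $B_{\hat r_i}(\hat x_i)\subseteq\mathcal X$, a pair from $\mathcal D$ (written $(x_i,x_i^+)$ as the node's pair), a radius $r_i$ with $B_{\hat r_i}(\hat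 x_i)\subseteq B_{r_i}(x_i)$, and a label $s_i\in\{1,0,-1\}$. Let $L_{\mathcal Q}$ be the set of leaves with label $1$, and put $\hat S(\mathcal Q)=\bigcup_{k\in L_{\mathcal Q}}B_{\hat r_k}(\hat x_k)$. **Algorithm 1.** The input is $\mathcal Q,\tau>0,L,\mathcal D$. Put $\hat S_0=\emptyset$ and $\hat S_1=\bigcup_{k\in L_{\mathcal Q}}B_{r_k}(x_k)$. While $\hat S_z\ne\hat S_{z-1}$, go once through the nodes of $\mathcal Q$ in the order of their indices (nodes appended on the way are visited too). At a leaf $i$ with $s_i=1$ let $B_i^+=B_{Lr_i}(x_i^+)$ and compare it with the current set $\hat S(\mathcal Q)$: if $B_i^+\subseteq\hat S(\mathcal Q)$, keep $s_i=1$; else, if $B_i^+\cap\hat S(\mathcal Q)=\emptyset$, set $s_i=0$; else, if $\hat r_i/2\ge\tau$, divide node $i$; else set $s_i=-1$. After the pass put $\hat S_{z+1}=\hat S(\mathcal Q)$ and increase $z$ by $1$. When the loop ends, return $\hat S_z$. Dividing node $i$ means that it stops being a leaf and that $2^n$ leaves $k$, one for each $v\in\{1,-1\}^n$, are appended, with $\hat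 r_k=\hat r_i/2$, $\hat x_k=\hat x_i+\hat r_kv$, $(x_k,x_k^+)\in\mathcal D$ a pair whose state $x_k$ is closest to $\hat x_k$ (ties broken by any fixed rule), $r_k=\hat r_k+\|\hat x_k-x_k\|_\infty$ and $s_k=1$. **Theorem.** Let $S\subseteq\mathcal X$ be a $\lambda$-contractive C-set (which need not be known), let $\lambda<\rho<1$, $\tau>0$, $0<\delta\le1$, and $\bar u=\max_{\|u\|_\infty\le1}\psi_S(u)$. Suppose $$\lambda+2\tau L\bar u\le\rho\le1-2\tau\bar u,\qquad M\ge\frac{\log\frac1\delta+\log\mathrm{vol}(\mathcal X)+n\log\frac1\tau}{-\log\left(1-\frac{\tau^n}{\mathrm{vol}(\mathcal X)}\right)},$$ and let the states $x_1,\dots,x_M$ be drawn independently from the uniform distribution on $\mathcal X$. Then, with probability at least $1-\delta$ over the data, the following holds for every initial tree $\mathcal Q$ (which may depend on the data) such that * $\rho S\subseteq\bigcup_{k\in L_{\mathcal Q}}B_{\hat r_k}(\hat x_k)$, and * for every $k\in L_{\mathcal Q}$, either $\hat r_k=2^m\tau$ for an integer $m\ge1$, or $\hat r_k\le\tau$ and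 the node carries the data that a division would assign to it, i.e. $x_k$ is a sampled state closest to $\hat x_k$ and $r_k=\hat r_k+\|\hat x_k-x_k\|_\infty$: Algorithm 1 terminates after finitely many steps and returns a PI set $\bigcup_{k\in L_{\mathcal Q'}}B_{\hat r_k}(\hat x_k)\supseteq\rho S$, where $\mathcal Q'$ is the final tree. -/

import Mathlib

open MeasureTheory ProbabilityTheory
open scoped Pointwise

noncomputable section

namespace PISet

/- Throughout, `Fin n → ℝ` carries the max norm, so `Metric.closedBall x r` is the hypercube
`B_{r,∞}(x)`. -/

/-- A C-set: a convex compact set containing the origin in its interior. -/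
def IsCSet {n : ℕ} (S : Set (Fin n → ℝ)) : Prop :=
  Convex ℝ S ∧ IsCompact S ∧ (0 : Fin n → ℝ) ∈ interior S

/-- `S` is a `lam`-contractive C-set for `x⁺ = T x`. Mathlib's `gauge S` is the Minkowski function
of `S`. -/
def IsContractive {n : ℕ} (T : (Fin n → ℝ) → (Fin n → ℝ)) (lam : ℝ) (S : Set (Fin n → ℝ)) : Prop :=
  0 ≤ lam ∧ lam < 1 ∧ IsCSet S ∧ ∀ x ∈ S, gauge S (T x) ≤ lam

/-- `ū`, the maximum of the Minkowski function of `S` over the unit ball of the max norm. -/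
def ubar {n : ℕ} (S : Set (Fin n → ℝ)) : ℝ :=
  sSup (gauge S '' Metric.closedBall 0 1)

/-- Positive invariance. -/
def IsPI {n : ℕ} (T : (Fin n → ℝ) → (Fin n → ℝ)) (O : Set (Fin n → ℝ)) : Prop :=
  ∀ x₀ ∈ O, ∀ k : ℕ, T^[k] x₀ ∈ O

/-- Labels of nodes: `s = 1`, `s = 0`, `s = -1` respectively. -/
inductive Label where
  | included
  | excluded
  | unknown

/-- A node of the tree: target radius and centre (they give the hypercube of the partition), the
radius of the hypercube around the sample, the sampled pair `(x, x⁺)`, the label, and whether the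
node is currently a leaf. -/
structure Node (n : ℕ) where
  tradius : ℝ
  tcenter : Fin n → ℝ
  radius : ℝ
  sample : (Fin n → ℝ) × (Fin n → ℝ)
  label : Label
  isLeaf : Bool

/-- The hypercube of the partition belonging to a node. -/
def Node.cube {n : ℕ} (q : Node n) : Set (Fin n → ℝ) :=
  Metric.closedBall q.tcenter q.tradius

/-- Membership in the index set `L_Q`: leaves with label `s = 1`. -/
def Node.Active {n : ℕ} (q : Node n) : Prop :=
  q.isLeaf = true ∧ q.label = Label.included

/-- The union of the partition hypercubes over all leaves with label `s = 1`. -/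
def candidate {n : ℕ} (Q : List (Node n)) : Set (Fin n → ℝ) :=
  ⋃ q ∈ {q | q ∈ Q ∧ q.Active}, q.cube

/-- The union of the hypercubes around the samples over all leaves with label `s = 1`. -/
def sampleCover {n : ℕ} (Q : List (Node n)) : Set (Fin n → ℝ) :=
  ⋃ q ∈ {q | q ∈ Q ∧ q.Active}, Metric.closedBall q.sample.1 q.radius

/-- `Q`, listed as nodes `1, …, N`, is a tree data structure for the constraint set `X` and the
data set `D`: each hypercube of the partition lies in `X`, and it is contained in the hypercube
around the sample that the node carries. -/
def IsTree {n M : ℕ} (X : Set (Fin n → ℝ)) (D : Fin M → (Fin n → ℝ) × (Fin n → ℝ))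
    (Q : List (Node n)) : Prop :=
  ∀ q ∈ Q, 0 < q.tradius ∧ q.cube ⊆ X ∧ q.sample ∈ Set.range D ∧
    q.cube ⊆ Metric.closedBall q.sample.1 q.radius

/-- `p` is a pair of the data set whose state is closest to `c`. -/
def IsNearest {n M : ℕ} (D : Fin M → (Fin n → ℝ) × (Fin n → ℝ)) (c : Fin n → ℝ)
    (p : (Fin n → ℝ) × (Fin n → ℝ)) : Prop :=
  p ∈ Set.range D ∧ ∀ j, ‖c - p.1‖ ≤ ‖c - (D j).1‖

/-- Repeated halving of the node's hypercube ends exactly at radius `τ`, unless the radius is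
already at most `τ`, in which case the node carries the sample and the radius that a division step
would assign to it. -/
def Node.Startable {n M : ℕ} (D : Fin M → (Fin n → ℝ) × (Fin n → ℝ)) (τ : ℝ)
    (q : Node n) : Prop :=
  (τ < q.tradius → ∃ m : ℕ, q.tradius = 2 ^ m * τ) ∧
  (q.tradius ≤ τ →
    IsNearest D q.tcenter q.sample ∧ q.radius = q.tradius + ‖q.tcenter - q.sample.1‖)

/-- The child of `q` in direction `v ∈ {1, -1}ⁿ` (`true` encodes `1`); `sel c` is the sampled pair
chosen by the argmin over the data set. -/
def child {n : ℕ} (sel : (Fin n → ℝ) → (Fin n → ℝ) × (Fin n → ℝ)) (q : Node n)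
    (v : Fin n → Bool) : Node n :=
  let r := q.tradius / 2
  let c := q.tcenter + r • (fun i => if v i then (1 : ℝ) else -1)
  { tradius := r
    tcenter := c
    radius := r + ‖c - (sel c).1‖
    sample := sel c
    label := Label.included
    isLeaf := true }

/-- Division of node `i`, whose content is `q`: the node stops being a leaf, and its `2ⁿ` children
are appended to the list of nodes. -/
def divide {n : ℕ} (sel : (Fin n → ℝ) → (Fin n → ℝ) × (Fin n → ℝ)) (Q : List (Node n)) (i : ℕ)
    (q : Node n) : List (Node n) :=
  Q.set i { q with isLeaf := false } ++
    (Finset.univ : Finset (Fin n → Bool)).toList.map (child sel q)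

open Classical in
/-- The body of the for-loop at node `i`. The current candidate set is recomputed from the current
tree after every change, so it is `candidate Q`. -/
def forBody {n : ℕ} (L τ : ℝ) (sel : (Fin n → ℝ) → (Fin n → ℝ) × (Fin n → ℝ))
    (Q : List (Node n)) (i : ℕ) : List (Node n) :=
  match Q[i]? with
  | none => Q
  | some q =>
    if q.Active then
      let Bplus := Metric.closedBall q.sample.2 (L * q.radius)
      if Bplus ∩ candidate Q = Bplus then
        Q.set i { q with label := Label.included }
      else if Bplus ∩ candidate Q = ∅ then
        Q.set i { q with label := Label.excluded }
      else if τ ≤ q.tradius / 2 then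
        divide sel Q i q
      else
        Q.set i { q with label := Label.unknown }
    else Q

/-- `ForLoop L τ sel Q i Q'`: the for-loop over the nodes of the tree, started at node `i` with tree
`Q`, ends with tree `Q'`. The nodes are visited in the order of their indices; nodes appended by
a division belong to the tree and are visited too. -/
inductive ForLoop {n : ℕ} (L τ : ℝ) (sel : (Fin n → ℝ) → (Fin n → ℝ) × (Fin n → ℝ)) :
    List (Node n) → ℕ → List (Node n) → Prop
  | done (Q : List (Node n)) (i : ℕ) (h : Q.length ≤ i) : ForLoop L τ sel Q i Q
  | next (Q Q' : List (Node n)) (i : ℕ) (h : i < Q.length)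
      (hrest : ForLoop L τ sel (forBody L τ sel Q i) (i + 1) Q') : ForLoop L τ sel Q i Q'

/-- `WhileLoop L τ sel Snew Sold Q Q' O`: the while-loop, entered with `Ŝ_z = Snew`,
`Ŝ_{z-1} = Sold` and tree `Q`, ends after finitely many iterations with tree `Q'` and set `O`. -/
inductive WhileLoop {n : ℕ} (L τ : ℝ) (sel : (Fin n → ℝ) → (Fin n → ℝ) × (Fin n → ℝ)) :
    Set (Fin n → ℝ) → Set (Fin n → ℝ) → List (Node n) → List (Node n) → Set (Fin n → ℝ) → Prop
  | finish (Snew Sold : Set (Fin n → ℝ)) (Q : List (Node n)) (h : Snew = Sold) :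
      WhileLoop L τ sel Snew Sold Q Q Snew
  | iter (Snew Sold : Set (Fin n → ℝ)) (Q Q₁ Q' : List (Node n)) (O : Set (Fin n → ℝ))
      (h : Snew ≠ Sold) (hfor : ForLoop L τ sel Q 0 Q₁)
      (hrest : WhileLoop L τ sel (candidate Q₁) Snew Q₁ Q' O) :
      WhileLoop L τ sel Snew Sold Q Q' O

/-- The algorithm, run on the tree `Q` with Lipschitz bound `L`, minimum radius `τ` and argmin `sel`
over the data set, terminates with final tree `Q'` and returns the set `O`. -/
def AlgorithmReturns {n : ℕ} (L τ : ℝ) (sel : (Fin n → ℝ) → (Fin n → ℝ) × (Fin n → ℝ))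
    (Q Q' : List (Node n)) (O : Set (Fin n → ℝ)) : Prop :=
  WhileLoop L τ sel (sampleCover Q) ∅ Q Q' O

end PISet

end

/-! The candidate set never loses a point of `ρ • S`. Suppose a cube contains `y ∈ ρ • S`. Its node
is never excluded: `T y` lies in the image ball (`Setting.map_mem_imageBall`) and, by contractivity,
in `ρ • S`, hence in the candidate set. Nor does it become unknown: once it is too small to divide,
density of the data puts its sample within `2 * τ` of `y`, hence in `S`. The image ball then has
radius at most `2 * τ * L` around a point of gauge at most `lam`, so it lies in `ρ • S`
(`Setting.imageBall_subset`). Division leaves the candidate set unchanged.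

Each deactivation or division lowers a natural-number potential, so the loops end. A leaf active
after a pass has its image ball in the candidate set from before that pass; when the two sets agree,
the result is positively invariant.

Chance enters only through density (`exists_event_samples_dense`), a union bound over disjoint grid
cells. That event does not involve the tree, so the tree may depend on the data. -/

namespace PISet

/-! ### The Minkowski function of a C-set -/

section Gauge

variable {n : ℕ} {S : Set (Fin n → ℝ)}

theorem IsCSet.mem_nhds_zero (hS : IsCSet S) : S ∈ nhds (0 : Fin n → ℝ) :=
  mem_interior_iff_mem_nhds.1 hS.2.2

theorem IsCSet.gauge_le_one_iff (hS : IsCSet S) {x : Fin n → ℝ} : gauge S x ≤ 1 ↔ x ∈ S := by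
  rw [gauge_le_one_iff_mem_closure hS.1 hS.mem_nhds_zero, hS.2.1.isClosed.closure_eq]

theorem IsCSet.mem_smul_iff (hS : IsCSet S) {r : ℝ} (hr : 0 < r) {x : Fin n → ℝ} :
    x ∈ r • S ↔ gauge S x ≤ r := by
  rw [Set.mem_smul_set_iff_inv_smul_mem₀ hr.ne', ← hS.gauge_le_one_iff,
    gauge_smul_of_nonneg (inv_nonneg.2 hr.le), smul_eq_mul, inv_mul_le_iff₀ hr, mul_one]

theorem IsCSet.gauge_le_ubar (hS : IsCSet S) {u : Fin n → ℝ} (hu : ‖u‖ ≤ 1) :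
    gauge S u ≤ ubar S := by
  refine le_csSup ?_ ⟨u, by simpa using hu, rfl⟩
  exact ((isCompact_closedBall _ _).image (continuous_gauge hS.1 hS.mem_nhds_zero)).bddAbove

theorem IsCSet.ubar_nonneg (hS : IsCSet S) : 0 ≤ ubar S :=
  (gauge_nonneg 0).trans (hS.gauge_le_ubar (u := 0) (by simp))

theorem IsCSet.gauge_le_norm_mul_ubar (hS : IsCSet S) (v : Fin n → ℝ) :
    gauge S v ≤ ‖v‖ * ubar S := by
  rcases eq_or_ne v 0 with rfl | hv
  · simp
  have hv' : 0 < ‖v‖ := norm_pos_iff.2 hv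
  have h := hS.gauge_le_ubar (u := ‖v‖⁻¹ • v) (by simp [norm_smul, hv'.ne'])
  rwa [gauge_smul_of_nonneg (inv_nonneg.2 hv'.le), smul_eq_mul, inv_mul_le_iff₀ hv'] at h

/-- Subadditivity makes the gauge Lipschitz with constant `ubar S`; this converts every radius into
a margin of the gauge. -/
theorem IsCSet.gauge_le_add (hS : IsCSet S) {x y : Fin n → ℝ} {r : ℝ} (h : dist y x ≤ r) :
    gauge S y ≤ gauge S x + r * ubar S := by
  have h1 : gauge S (x + (y - x)) ≤ gauge S x + gauge S (y - x) :=
    gauge_add_le hS.1 (absorbent_nhds_zero hS.mem_nhds_zero) _ _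
  rw [add_sub_cancel] at h1
  have h2 := hS.gauge_le_norm_mul_ubar (y - x)
  rw [dist_eq_norm] at h
  have h3 := mul_le_mul_of_nonneg_right h hS.ubar_nonneg
  linarith

end Gauge

/-! ### Density of uniform samples -/

section Sampling

variable {n : ℕ}

/-- The half-open cell of the grid of width `τ` with lower corner `τ z`. -/
def gridCell (τ : ℝ) (z : Fin n → ℤ) : Set (Fin n → ℝ) :=
  Set.pi Set.univ fun i => Set.Ico (τ * z i) (τ * (z i + 1))

theorem measurableSet_gridCell (τ : ℝ) (z : Fin n → ℤ) : MeasurableSet (gridCell τ z) :=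
  MeasurableSet.univ_pi fun _ => measurableSet_Ico

theorem volume_real_gridCell {τ : ℝ} (hτ : 0 < τ) (z : Fin n → ℤ) :
    volume.real (gridCell τ z) = τ ^ n := by
  rw [Measure.real, gridCell, Real.volume_pi_Ico_toReal]
  · simp [mul_add]
  · intro i
    simp only [mul_add]
    linarith

theorem disjoint_gridCell {τ : ℝ} (hτ : 0 < τ) {z w : Fin n → ℤ} (h : z ≠ w) :
    Disjoint (gridCell τ z) (gridCell τ w) := by
  rw [Set.disjoint_left]
  intro y hz hw
  apply h
  funext i
  have h1 := hz i trivial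
  have h2 := hw i trivial
  simp only [Set.mem_Ico] at h1 h2
  have h3 := lt_of_mul_lt_mul_left (h1.1.trans_lt h2.2) hτ.le
  have h4 := lt_of_mul_lt_mul_left (h2.1.trans_lt h1.2) hτ.le
  norm_cast at h3 h4
  omega

/-- In each coordinate the first grid point at or above `c i - τ` lies below `c i`, so a whole grid
step fits before `c i + τ`. -/
theorem exists_gridCell_subset_closedBall {τ : ℝ} (hτ : 0 < τ) (c : Fin n → ℝ) :
    ∃ z : Fin n → ℤ, gridCell τ z ⊆ Metric.closedBall c τ := by
  refine ⟨fun i => ⌈(c i - τ) / τ⌉, fun y hy => ?_⟩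
  rw [Metric.mem_closedBall, dist_pi_le_iff hτ.le]
  intro i
  have h := hy i trivial
  simp only [Set.mem_Ico] at h
  have h1 : (c i - τ) / τ ≤ ⌈(c i - τ) / τ⌉ := Int.le_ceil _
  have h2 : (⌈(c i - τ) / τ⌉ : ℝ) < (c i - τ) / τ + 1 := Int.ceil_lt_add_one _
  have e : τ * ((c i - τ) / τ) = c i - τ := by field_simp
  have h3 := mul_le_mul_of_nonneg_left h1 hτ.le
  have h4 := mul_lt_mul_of_pos_left h2 hτ
  rw [Real.dist_eq, abs_le]
  constructor <;> nlinarith [h.1, h.2]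

/-- By disjointness, the number of events in the union bound is at most the inverse of the
probability of hitting one cell. -/
theorem card_mul_le_of_gridCell_subset {τ : ℝ} (hτ : 0 < τ) {X : Set (Fin n → ℝ)}
    (hX : volume X ≠ ⊤) (F : Finset (Fin n → ℤ)) (hF : ∀ z ∈ F, gridCell τ z ⊆ X) :
    F.card * τ ^ n ≤ volume.real X := by
  calc (F.card : ℝ) * τ ^ n = ∑ z ∈ F, volume.real (gridCell τ z) := by
        simp [volume_real_gridCell hτ]
    _ = volume.real (⋃ z ∈ F, gridCell τ z) := by
        rw [measureReal_biUnion_finset (fun z _ w _ h => disjoint_gridCell hτ h)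
          (fun z _ => measurableSet_gridCell τ z)
          (fun z hz => measure_ne_top_of_subset (hF z hz) hX)]
    _ ≤ volume.real X := measureReal_mono (Set.iUnion₂_subset hF) hX

theorem finite_gridCell_subset {τ : ℝ} (hτ : 0 < τ) {X : Set (Fin n → ℝ)}
    (hX : volume X ≠ ⊤) : {z : Fin n → ℤ | gridCell τ z ⊆ X}.Finite := by
  by_contra hinf
  obtain ⟨N, hN⟩ := exists_nat_gt (volume.real X / τ ^ n)
  obtain ⟨F, hF, hc⟩ := Set.Infinite.exists_subset_card_eq hinf N
  have h := card_mul_le_of_gridCell_subset hτ hX F fun z hz => hF hz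
  rw [div_lt_iff₀ (pow_pos hτ n), ← hc] at hN
  linarith

/-- With `p = τ ^ n / V` there are at most `1 / p` cells, so each may be missed with probability `δ
* p`. Strictness in `hV` keeps `1 - p` positive; at `p = 1` the quotient in `hM` would be a division
by zero and carry no information. -/
theorem pow_le_of_sample_bound {M : ℕ} {τ δ V : ℝ} (hτ : 0 < τ) (hδ : 0 < δ)
    (hV : τ ^ n < V)
    (hM : (Real.log (1 / δ) + Real.log V + n * Real.log (1 / τ)) /
        (-Real.log (1 - τ ^ n / V)) ≤ (M : ℝ)) :
    (1 - τ ^ n / V) ^ M ≤ δ * (τ ^ n / V) := by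
  have hτn : 0 < τ ^ n := pow_pos hτ n
  have hV0 : 0 < V := hτn.trans hV
  have hp0 : 0 < τ ^ n / V := div_pos hτn hV0
  have hp1 : τ ^ n / V < 1 := (div_lt_one hV0).2 hV
  have hlog : Real.log (1 - τ ^ n / V) < 0 := Real.log_neg (by linarith) (by linarith)
  rw [div_le_iff₀ (by linarith)] at hM
  rw [← Real.log_le_log_iff (pow_pos (by linarith) M) (mul_pos hδ hp0), Real.log_pow,
    Real.log_mul hδ.ne' hp0.ne', Real.log_div hτn.ne' hV0.ne', Real.log_pow]
  simp only [one_div, Real.log_inv] at hM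
  linarith

variable {Ω : Type*} [MeasurableSpace Ω] {P : Measure Ω}

theorem measureReal_preimage_of_isUniform {X A : Set (Fin n → ℝ)} (hX0 : volume X ≠ 0)
    (hX : volume X ≠ ⊤) (hA : MeasurableSet A) (hAX : A ⊆ X) {x : Ω → Fin n → ℝ}
    (hx : pdf.IsUniform x X P volume) :
    P.real (x ⁻¹' A) = volume.real A / volume.real X := by
  rw [Measure.real, hx.measure_preimage hX0 hX hA, Set.inter_eq_self_of_subset_right hAX,
    ENNReal.toReal_div]
  rfl

/-- With high probability all samples lie in `X` and every max-norm ball of radius `τ` in `X`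
contains a sample. -/
theorem exists_event_samples_dense [IsProbabilityMeasure P] {M : ℕ} {X : Set (Fin n → ℝ)} (hX : volume X ≠ ⊤)
    (hXm : MeasurableSet X) {τ δ : ℝ} (hτ : 0 < τ) (hδ : 0 < δ)
    (hV : τ ^ n < volume.real X)
    (hM : (Real.log (1 / δ) + Real.log (volume.real X) + n * Real.log (1 / τ)) /
        (-Real.log (1 - τ ^ n / volume.real X)) ≤ (M : ℝ))
    {x : Fin M → Ω → (Fin n → ℝ)} (hxm : ∀ j, Measurable (x j))
    (hxind : iIndepFun x P) (hxunif : ∀ j, pdf.IsUniform (x j) X P volume) :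
    ∃ E : Set Ω, MeasurableSet E ∧ ENNReal.ofReal (1 - δ) ≤ P E ∧
      ∀ ω ∈ E, (∀ j, x j ω ∈ X) ∧
        ∀ c, Metric.closedBall c τ ⊆ X → ∃ j, ‖c - x j ω‖ ≤ τ := by
  have hτn : 0 < τ ^ n := pow_pos hτ n
  have hV0 : 0 < volume.real X := hτn.trans hV
  have hX0 : volume X ≠ 0 := fun h => by simp [Measure.real, h] at hV0
  set F := (finite_gridCell_subset hτ hX).toFinset with hFdef
  have hF : ∀ z, z ∈ F ↔ gridCell τ z ⊆ X := fun z => by simp [hFdef]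
  -- `A z`: every sample misses the cell. `B`: some sample leaves `X`, a null event.
  let A : (Fin n → ℤ) → Set Ω := fun z => ⋂ j, x j ⁻¹' (gridCell τ z)ᶜ
  let B : Set Ω := ⋃ j, x j ⁻¹' Xᶜ
  have hAm : ∀ z, MeasurableSet (A z) := fun z =>
    MeasurableSet.iInter fun j => hxm j (measurableSet_gridCell τ z).compl
  have hBm : MeasurableSet B := MeasurableSet.iUnion fun j => hxm j hXm.compl
  have hUm : MeasurableSet ((⋃ z ∈ F, A z) ∪ B) :=
    (F.measurableSet_biUnion fun z _ => hAm z).union hBm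
  have hPA : ∀ z ∈ F, P.real (A z) = (1 - τ ^ n / volume.real X) ^ M := by
    intro z hz
    have h := hxind.measure_inter_preimage_eq_mul Finset.univ
      (sets := fun _ => (gridCell τ z)ᶜ) fun j _ => (measurableSet_gridCell τ z).compl
    simp only [Finset.mem_univ, Set.iInter_true] at h
    have h' : ∀ j, P.real (x j ⁻¹' (gridCell τ z)ᶜ) = 1 - τ ^ n / volume.real X := by
      intro j
      rw [Set.preimage_compl, probReal_compl_eq_one_sub (hxm j (measurableSet_gridCell τ z)),
        measureReal_preimage_of_isUniform hX0 hX (measurableSet_gridCell τ z) ((hF z).1 hz)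
          (hxunif j), volume_real_gridCell hτ]
    simp only [Measure.real] at h' ⊢
    rw [h, ENNReal.toReal_prod, Finset.prod_congr rfl fun j _ => h' j]
    simp
  have hPB : P B = 0 := by
    rw [measure_iUnion_null_iff]
    intro j
    rw [(hxunif j).measure_preimage hX0 hX hXm.compl]
    simp
  have hcount := card_mul_le_of_gridCell_subset hτ hX F fun z hz => (hF z).1 hz
  have hle : P.real ((⋃ z ∈ F, A z) ∪ B) ≤ δ := by
    calc P.real ((⋃ z ∈ F, A z) ∪ B) ≤ P.real (⋃ z ∈ F, A z) + P.real B :=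
          measureReal_union_le _ _
      _ ≤ (∑ z ∈ F, P.real (A z)) + 0 :=
          add_le_add (measureReal_biUnion_finset_le _ _) (by simp [Measure.real, hPB])
      _ = F.card * (1 - τ ^ n / volume.real X) ^ M := by
          rw [Finset.sum_congr rfl hPA]
          simp
      _ ≤ F.card * (δ * (τ ^ n / volume.real X)) := by
          gcongr
          exact pow_le_of_sample_bound hτ hδ hV hM
      _ = δ * ((F.card * τ ^ n) / volume.real X) := by ring
      _ ≤ δ * 1 := by
          gcongr
          exact (div_le_one hV0).2 hcount
      _ = δ := mul_one δ
  refine ⟨((⋃ z ∈ F, A z) ∪ B)ᶜ, hUm.compl, ?_, fun ω hω => ?_⟩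
  · apply ENNReal.ofReal_le_of_le_toReal
    have := probReal_compl_eq_one_sub (μ := P) hUm
    simp only [Measure.real] at this hle
    linarith
  · simp only [Set.mem_compl_iff, Set.mem_union, Set.mem_iUnion, Set.mem_iInter, A, B,
      Set.mem_preimage, not_or, not_exists, not_forall, not_not] at hω
    refine ⟨hω.2, fun c hc => ?_⟩
    obtain ⟨z, hz⟩ := exists_gridCell_subset_closedBall hτ c
    obtain ⟨j, hj⟩ := hω.1 z ((hF z).2 (hz.trans hc))
    refine ⟨j, ?_⟩
    rw [← dist_eq_norm, dist_comm]
    exact hz hj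

end Sampling

/-! ### Cubes meeting `ρ • S` -/

section Geometry

variable {n M : ℕ}

/-- The deterministic hypotheses of the algorithm: the system is Lipschitz on `X`, the parameters
match the contractive set `S`, and the data are dense in `X` up to `τ`. -/
structure Setting (X : Set (Fin n → ℝ)) (T : (Fin n → ℝ) → (Fin n → ℝ)) (L : ℝ)
    (S : Set (Fin n → ℝ)) (lam ρ τ : ℝ) (D : Fin M → (Fin n → ℝ) × (Fin n → ℝ)) : Prop where
  L_pos : 0 < L
  lipschitz : ∀ p ∈ X, ∀ q ∈ X, ‖T p - T q‖ ≤ L * ‖p - q‖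
  subset : S ⊆ X
  contractive : IsContractive T lam S
  lam_lt : lam < ρ
  τ_pos : 0 < τ
  low : lam + 2 * τ * L * ubar S ≤ ρ
  up : ρ ≤ 1 - 2 * τ * ubar S
  data : ∀ j, (D j).1 ∈ X ∧ (D j).2 = T (D j).1
  dense : ∀ c, Metric.closedBall c τ ⊆ X → ∃ j, ‖c - (D j).1‖ ≤ τ

/-- The hypercube around the image of the sample carried by a node. -/
def Node.imageBall (L : ℝ) (q : Node n) : Set (Fin n → ℝ) :=
  Metric.closedBall q.sample.2 (L * q.radius)

/-- The conditions that `IsTree` imposes on a single node. -/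
def Node.Valid (X : Set (Fin n → ℝ)) (D : Fin M → (Fin n → ℝ) × (Fin n → ℝ)) (q : Node n) :
    Prop :=
  0 < q.tradius ∧ q.cube ⊆ X ∧ q.sample ∈ Set.range D ∧
    q.cube ⊆ Metric.closedBall q.sample.1 q.radius

variable {X : Set (Fin n → ℝ)} {T : (Fin n → ℝ) → (Fin n → ℝ)} {L : ℝ}
  {S : Set (Fin n → ℝ)} {lam ρ τ : ℝ} {D : Fin M → (Fin n → ℝ) × (Fin n → ℝ)}

theorem Setting.rho_pos (h : Setting X T L S lam ρ τ D) : 0 < ρ :=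
  h.contractive.1.trans_lt h.lam_lt

theorem Setting.closedBall_subset (h : Setting X T L S lam ρ τ D) {x : Fin n → ℝ}
    (hx : x ∈ ρ • S) : Metric.closedBall x (2 * τ) ⊆ S := by
  intro y hy
  have hS := h.contractive.2.2.1
  rw [hS.mem_smul_iff h.rho_pos] at hx
  rw [← hS.gauge_le_one_iff]
  have := hS.gauge_le_add (Metric.mem_closedBall.1 hy)
  linarith [h.up]

theorem Setting.smul_subset (h : Setting X T L S lam ρ τ D) : ρ • S ⊆ S := fun _ hx =>
  h.closedBall_subset hx (Metric.mem_closedBall_self (by linarith [h.τ_pos]))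

theorem Setting.map_mem (h : Setting X T L S lam ρ τ D) {x : Fin n → ℝ} (hx : x ∈ S) :
    T x ∈ ρ • S := by
  rw [h.contractive.2.2.1.mem_smul_iff h.rho_pos]
  exact (h.contractive.2.2.2 x hx).trans h.lam_lt.le

theorem Setting.map_mem_imageBall (h : Setting X T L S lam ρ τ D) {q : Node n}
    (hq : q.Valid X D) {y : Fin n → ℝ} (hy : y ∈ q.cube) : T y ∈ q.imageBall L := by
  obtain ⟨-, hX, ⟨j, hj⟩, hr⟩ := hq
  obtain ⟨h1, h2⟩ := h.data j
  rw [hj] at h1 h2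
  rw [Node.imageBall, Metric.mem_closedBall, dist_eq_norm, h2]
  refine (h.lipschitz y (hX hy) _ h1).trans (mul_le_mul_of_nonneg_left ?_ h.L_pos.le)
  rw [← dist_eq_norm]
  exact hr hy

/-- A node at the minimum radius whose hypercube meets `ρ S` keeps its label. -/
theorem Setting.imageBall_subset (h : Setting X T L S lam ρ τ D) {q : Node n}
    (hq : q.Valid X D) (hst : q.Startable D τ) (hsmall : ¬ τ ≤ q.tradius / 2)
    {y : Fin n → ℝ} (hy : y ∈ q.cube) (hyS : y ∈ ρ • S) : q.imageBall L ⊆ ρ • S := by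
  have hτ := h.τ_pos
  have hS := h.contractive.2.2.1
  -- A radius `2 ^ (m + 1) * τ` could still be halved.
  have hle : q.tradius ≤ τ := by
    by_contra! hlt
    obtain ⟨m, hm⟩ := hst.1 hlt
    rcases m with _ | m
    · simp at hm
      linarith
    · apply hsmall
      have : (1 : ℝ) ≤ 2 ^ m := one_le_pow₀ (by norm_num)
      rw [hm, pow_succ]
      nlinarith
  obtain ⟨⟨-, hmin⟩, hrad⟩ := hst.2 hle
  have hyc : dist y q.tcenter ≤ q.tradius := hy
  have hball := h.closedBall_subset hyS
  -- The centre is within `τ` of `y`, so its `τ`-ball stays in the `2 * τ`-ball around `y`.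
  obtain ⟨j, hj⟩ := h.dense q.tcenter (by
    refine (Metric.closedBall_subset_closedBall' ?_).trans (hball.trans h.subset)
    rw [dist_comm]
    linarith)
  have hr : q.radius ≤ 2 * τ := by
    have := hmin j
    linarith
  have hsS : q.sample.1 ∈ S := by
    apply hball
    have := hq.2.2.2 hy
    rw [Metric.mem_closedBall] at this ⊢
    rw [dist_comm]
    linarith
  obtain ⟨i, hi⟩ := hq.2.2.1
  have hT : q.sample.2 = T q.sample.1 := by
    rw [← hi]
    exact (h.data i).2
  intro w hw
  rw [hS.mem_smul_iff h.rho_pos]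
  have h1 := hS.gauge_le_add (Metric.mem_closedBall.1 hw)
  have h2 := h.contractive.2.2.2 _ hsS
  rw [← hT] at h2
  have h3 : L * q.radius * ubar S ≤ L * (2 * τ) * ubar S :=
    mul_le_mul_of_nonneg_right (mul_le_mul_of_nonneg_left hr h.L_pos.le) hS.ubar_nonneg
  linarith [h.low]

end Geometry

/-! ### Candidate sets, division and the potential -/

section Tree

variable {n M : ℕ}

theorem mem_candidate {Q : List (Node n)} {y : Fin n → ℝ} :
    y ∈ candidate Q ↔ ∃ q ∈ Q, q.Active ∧ y ∈ q.cube := by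
  simp only [candidate, Set.mem_iUnion, Set.mem_ofPred_eq, exists_prop, and_assoc]

theorem candidate_append (Q R : List (Node n)) :
    candidate (Q ++ R) = candidate Q ∪ candidate R := by
  ext y
  simp only [Set.mem_union, mem_candidate, List.mem_append, or_and_right, exists_or]

theorem candidate_cons_of_active {q : Node n} (hq : q.Active) (Q : List (Node n)) :
    candidate (q :: Q) = q.cube ∪ candidate Q := by
  ext y
  simp [mem_candidate, hq]

theorem candidate_cons_of_not_active {q : Node n} (hq : ¬ q.Active) (Q : List (Node n)) :
    candidate (q :: Q) = candidate Q := by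
  ext y
  simp [mem_candidate, hq]

theorem candidate_subset_sampleCover {Q : List (Node n)}
    (h : ∀ q ∈ Q, q.cube ⊆ Metric.closedBall q.sample.1 q.radius) :
    candidate Q ⊆ sampleCover Q :=
  Set.iUnion₂_mono fun q hq => h q hq.1

variable {sel : (Fin n → ℝ) → (Fin n → ℝ) × (Fin n → ℝ)}

theorem child_active (q : Node n) (v : Fin n → Bool) : (child sel q v).Active :=
  ⟨rfl, rfl⟩

theorem child_cube_subset {q : Node n} (hq : 0 < q.tradius) (v : Fin n → Bool) :
    (child sel q v).cube ⊆ q.cube := by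
  apply Metric.closedBall_subset_closedBall'
  simp only [child, dist_eq_norm, add_sub_cancel_left]
  have : ‖(q.tradius / 2) • (fun i => if v i then (1 : ℝ) else -1)‖ ≤ q.tradius / 2 := by
    rw [pi_norm_le_iff_of_nonneg (by linarith)]
    intro i
    simp only [Pi.smul_apply, smul_eq_mul, norm_mul, Real.norm_eq_abs, abs_of_pos (half_pos hq)]
    split_ifs <;> simp
  linarith

theorem exists_mem_child_cube {q : Node n} (hq : 0 < q.tradius) {y : Fin n → ℝ}
    (hy : y ∈ q.cube) : ∃ v, y ∈ (child sel q v).cube := by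
  refine ⟨fun i => decide (q.tcenter i ≤ y i), ?_⟩
  have hy' := (dist_pi_le_iff hq.le).1 (Metric.mem_closedBall.1 hy)
  apply Metric.mem_closedBall.2
  simp only [child]
  rw [dist_pi_le_iff (by linarith)]
  intro i
  have h := hy' i
  rw [Real.dist_eq, abs_le] at h ⊢
  simp only [Pi.add_apply, Pi.smul_apply, smul_eq_mul, decide_eq_true_eq]
  split_ifs with hc
  · constructor <;> linarith
  · push Not at hc
    constructor <;> linarith

theorem candidate_children {q : Node n} (hq : 0 < q.tradius) :
    candidate ((Finset.univ : Finset (Fin n → Bool)).toList.map (child sel q)) = q.cube := by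
  ext y
  simp only [mem_candidate, List.mem_map, Finset.mem_toList, Finset.mem_univ, true_and,
    exists_exists_eq_and, child_active]
  exact ⟨fun ⟨v, hv⟩ => child_cube_subset hq v hv, exists_mem_child_cube hq⟩

variable {X : Set (Fin n → ℝ)} {D : Fin M → (Fin n → ℝ) × (Fin n → ℝ)}

theorem Node.Valid.child {q : Node n} (hq : q.Valid X D) (hsel : ∀ c, IsNearest D c (sel c))
    (v : Fin n → Bool) : (child sel q v).Valid X D := by
  refine ⟨half_pos hq.1, (child_cube_subset hq.1 v).trans hq.2.1, (hsel _).1, ?_⟩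
  apply Metric.closedBall_subset_closedBall'
  rw [dist_eq_norm]
  exact le_rfl

theorem Node.Startable.child {τ : ℝ} (hτ : 0 < τ) {q : Node n} (hq : q.Startable D τ)
    (hsel : ∀ c, IsNearest D c (sel c)) (hle : τ ≤ q.tradius / 2) (v : Fin n → Bool) :
    (child sel q v).Startable D τ := by
  refine ⟨fun hlt => ?_, fun _ => ⟨hsel _, rfl⟩⟩
  obtain ⟨m, hm⟩ := hq.1 (by linarith)
  rcases m with _ | m
  · simp at hm
    linarith
  · exact ⟨m, by simp only [PISet.child, hm]; ring⟩

open Classical in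
/-- An upper bound for the number of operations that the descendants of a node may still need. -/
noncomputable def Node.weight (τ : ℝ) (q : Node n) : ℕ :=
  if q.Active then (2 ^ n + 1) ^ Nat.log 2 ⌊q.tradius / τ⌋₊ else 0

/-- The total weight of a tree. -/
noncomputable def potential (τ : ℝ) (Q : List (Node n)) : ℕ :=
  (Q.map (Node.weight τ)).sum

theorem weight_of_not_active {τ : ℝ} {q : Node n} (h : ¬ q.Active) : q.weight τ = 0 :=
  if_neg h

/-- Even a leaf with exponent `0` weighs `1`, so the potential registers every deactivation. -/
theorem weight_pos {τ : ℝ} {q : Node n} (h : q.Active) : 0 < q.weight τ := by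
  rw [Node.weight, if_pos h]
  positivity

/-- Halving the radius lowers the exponent by exactly one, and `2 ^ n * (2 ^ n + 1) ^ k < (2 ^ n +
1) ^ (k + 1)`. -/
theorem potential_children_lt {τ : ℝ} (hτ : 0 < τ) {q : Node n} (h : q.Active)
    (hle : τ ≤ q.tradius / 2) :
    potential τ ((Finset.univ : Finset (Fin n → Bool)).toList.map (child sel q))
      < q.weight τ := by
  have hfl : 2 ≤ ⌊q.tradius / τ⌋₊ := by
    apply Nat.le_floor
    rw [le_div_iff₀ hτ]
    push_cast
    linarith
  have hlog : 0 < Nat.log 2 ⌊q.tradius / τ⌋₊ := Nat.log_pos one_lt_two hfl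
  have hw : ∀ v, (child sel q v).weight τ =
      (2 ^ n + 1) ^ (Nat.log 2 ⌊q.tradius / τ⌋₊ - 1) := by
    intro v
    have : (child sel q v).tradius / τ = q.tradius / τ / 2 := div_right_comm _ _ _
    rw [Node.weight, if_pos (child_active q v), this, Nat.floor_div_ofNat]
    exact congrArg _ (Nat.log_div_base 2 _)
  have hmap : (Node.weight τ ∘ child sel q) =
      fun _ => (2 ^ n + 1) ^ (Nat.log 2 ⌊q.tradius / τ⌋₊ - 1) := funext hw
  rw [potential, List.map_map, hmap, Node.weight, if_pos h]
  obtain ⟨k, hk⟩ := Nat.exists_eq_add_of_lt hlog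
  rw [hk]
  simp only [List.map_const', Finset.length_toList, Finset.card_univ, Fintype.card_pi,
    Fintype.card_bool, Finset.prod_const, Fintype.card_fin, List.sum_replicate, smul_eq_mul,
    zero_add, Nat.add_sub_cancel, pow_succ (2 ^ n + 1) k]
  have : 0 < (2 ^ n + 1) ^ k := by positivity
  nlinarith

end Tree

/-! ### Invariant, termination and correctness -/

section Algorithm

variable {n M : ℕ} {X : Set (Fin n → ℝ)} {T : (Fin n → ℝ) → (Fin n → ℝ)} {L : ℝ}
  {S : Set (Fin n → ℝ)} {lam ρ τ : ℝ} {D : Fin M → (Fin n → ℝ) × (Fin n → ℝ)}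
  {sel : (Fin n → ℝ) → (Fin n → ℝ) × (Fin n → ℝ)}

/-- The invariant of the algorithm: `Q` is a tree with startable active nodes whose candidate set
contains `C`. -/
structure Admissible (X : Set (Fin n → ℝ)) (D : Fin M → (Fin n → ℝ) × (Fin n → ℝ)) (τ : ℝ)
    (C : Set (Fin n → ℝ)) (Q : List (Node n)) : Prop where
  valid : ∀ q ∈ Q, q.Valid X D
  startable : ∀ q ∈ Q, q.Active → q.Startable D τ
  subset : C ⊆ candidate Q

/-- Every active node maps into `O`. -/
def MapsInto (L : ℝ) (O : Set (Fin n → ℝ)) (Q : List (Node n)) : Prop :=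
  ∀ q ∈ Q, q.Active → q.imageBall L ⊆ O

/-- The effect of one visit of node `i`. -/
structure StepSpec (X : Set (Fin n → ℝ)) (D : Fin M → (Fin n → ℝ) × (Fin n → ℝ)) (L τ : ℝ)
    (C : Set (Fin n → ℝ)) (Q : List (Node n)) (i : ℕ) (Q' : List (Node n)) : Prop where
  admissible : Admissible X D τ C Q'
  candidate_subset : candidate Q' ⊆ candidate Q
  getElem_eq : ∀ j < i, Q'[j]? = Q[j]?
  imageBall_subset : ∀ q, Q'[i]? = some q → q.Active → q.imageBall L ⊆ candidate Q
  potential_lt : Q' = Q ∨ potential τ Q' < potential τ Q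
  measure_lt : Q'.length - (i + 1) + 2 ^ n * potential τ Q'
    < Q.length - i + 2 ^ n * potential τ Q

theorem potential_append (Q R : List (Node n)) :
    potential τ (Q ++ R) = potential τ Q + potential τ R := by
  simp [potential]

theorem potential_cons (q : Node n) (Q : List (Node n)) :
    potential τ (q :: Q) = q.weight τ + potential τ Q := by
  simp [potential]

theorem StepSpec.refl {C : Set (Fin n → ℝ)} {Q : List (Node n)} {i : ℕ}
    (hQ : Admissible X D τ C Q) (hi : i < Q.length)
    (h : ∀ q, Q[i]? = some q → q.Active → q.imageBall L ⊆ candidate Q) :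
    StepSpec X D L τ C Q i Q :=
  ⟨hQ, subset_rfl, fun _ _ => rfl, h, Or.inl rfl, by omega⟩

/-- Serves both the excluded and the unknown label: a cube disjoint from `C` can be dropped. -/
theorem StepSpec.deactivate {C : Set (Fin n → ℝ)} {l₁ l₂ : List (Node n)} {q q' : Node n}
    (hQ : Admissible X D τ C (l₁ ++ q :: l₂)) (hq : q.Active) (hq' : ¬ q'.Active)
    (hv : q'.Valid X D) (hC : ∀ y ∈ q.cube, y ∉ C) :
    StepSpec X D L τ C (l₁ ++ q :: l₂) l₁.length (l₁ ++ q' :: l₂) := by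
  have hpos := weight_pos (τ := τ) hq
  have hzero := weight_of_not_active (τ := τ) hq'
  have hpot : potential τ (l₁ ++ q' :: l₂) < potential τ (l₁ ++ q :: l₂) := by
    simp only [potential_append, potential_cons]
    omega
  have hcand : candidate (l₁ ++ q :: l₂) = candidate (l₁ ++ q' :: l₂) ∪ q.cube := by
    rw [candidate_append, candidate_append, candidate_cons_of_active hq,
      candidate_cons_of_not_active hq', Set.union_assoc, Set.union_comm q.cube]
  refine ⟨⟨?_, ?_, ?_⟩, ?_, ?_, ?_, Or.inr hpot, ?_⟩
  · intro p hp
    rcases List.mem_append.1 hp with h | h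
    · exact hQ.valid p (by simp [h])
    · rcases List.mem_cons.1 h with rfl | h
      · exact hv
      · exact hQ.valid p (by simp [h])
  · intro p hp hpa
    rcases List.mem_append.1 hp with h | h
    · exact hQ.startable p (by simp [h]) hpa
    · rcases List.mem_cons.1 h with rfl | h
      · exact absurd hpa hq'
      · exact hQ.startable p (by simp [h]) hpa
  · intro y hy
    have h := hQ.subset hy
    rw [hcand] at h
    exact h.resolve_right fun hc => hC y hc hy
  · rw [hcand]
    exact Set.subset_union_left
  · intro j hj
    rw [List.getElem?_append_left hj, List.getElem?_append_left hj]
  · intro p hp hpa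
    simp at hp
    exact absurd (hp ▸ hpa) hq'
  · have := Nat.mul_lt_mul_of_pos_left hpot (pow_pos two_pos n)
    simp only [List.length_append, List.length_cons]
    omega

/-- The image condition is vacuous here, as node `i` is no longer a leaf; the children are tested
when they are visited. -/
theorem StepSpec.divide {C : Set (Fin n → ℝ)} {l₁ l₂ : List (Node n)} {q : Node n}
    (hτ : 0 < τ) (hsel : ∀ c, IsNearest D c (sel c))
    (hQ : Admissible X D τ C (l₁ ++ q :: l₂)) (hq : q.Active) (hle : τ ≤ q.tradius / 2) :
    StepSpec X D L τ C (l₁ ++ q :: l₂) l₁.length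
      (divide sel (l₁ ++ q :: l₂) l₁.length q) := by
  set q' : Node n := { q with isLeaf := false } with hq'def
  set R := (Finset.univ : Finset (Fin n → Bool)).toList.map (child sel q) with hR
  have hdiv : PISet.divide sel (l₁ ++ q :: l₂) l₁.length q = l₁ ++ q' :: (l₂ ++ R) := by
    simp [PISet.divide, hR, hq'def]
  have hq' : ¬ q'.Active := fun h => Bool.false_ne_true h.1
  have hqm : q ∈ l₁ ++ q :: l₂ := by simp
  have hvq := hQ.valid q hqm
  have hRcard : R.length = 2 ^ n := by simp [hR]
  have hRpot : potential τ R < q.weight τ := potential_children_lt hτ hq hle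
  have hzero := weight_of_not_active (τ := τ) hq'
  have hpot : potential τ (l₁ ++ q' :: (l₂ ++ R)) < potential τ (l₁ ++ q :: l₂) := by
    simp only [potential_append, potential_cons]
    omega
  have hcand : candidate (l₁ ++ q' :: (l₂ ++ R)) = candidate (l₁ ++ q :: l₂) := by
    rw [candidate_append, candidate_append, candidate_cons_of_active hq,
      candidate_cons_of_not_active hq', candidate_append, hR, candidate_children hvq.1,
      Set.union_comm q.cube]
  have hRmem : ∀ p ∈ R, ∃ v, child sel q v = p := fun p hp => by simpa [hR] using hp
  rw [hdiv]
  refine ⟨⟨?_, ?_, hcand ▸ hQ.subset⟩, hcand.le, ?_, ?_, Or.inr hpot, ?_⟩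
  · intro p hp
    simp only [List.mem_append, List.mem_cons] at hp
    rcases hp with h | rfl | h | h
    · exact hQ.valid p (by simp [h])
    · exact hvq
    · exact hQ.valid p (by simp [h])
    · obtain ⟨v, rfl⟩ := hRmem p h
      exact hvq.child hsel v
  · intro p hp hpa
    simp only [List.mem_append, List.mem_cons] at hp
    rcases hp with h | rfl | h | h
    · exact hQ.startable p (by simp [h]) hpa
    · exact absurd hpa hq'
    · exact hQ.startable p (by simp [h]) hpa
    · obtain ⟨v, rfl⟩ := hRmem p h
      exact (hQ.startable q hqm hq).child hτ hsel hle v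
  · intro j hj
    rw [List.getElem?_append_left hj, List.getElem?_append_left hj]
  · intro p hp hpa
    simp at hp
    exact absurd (hp ▸ hpa) hq'
  -- A potential drop of at least one, times `2 ^ n`, pays for the appended nodes.
  · have := Nat.mul_le_mul_left (2 ^ n) (Nat.succ_le_of_lt hpot)
    rw [Nat.mul_succ] at this
    simp only [List.length_append, List.length_cons, hRcard]
    omega

theorem stepSpec_forBody (h : Setting X T L S lam ρ τ D) (hsel : ∀ c, IsNearest D c (sel c))
    {Q : List (Node n)} (hQ : Admissible X D τ (ρ • S) Q) {i : ℕ} (hi : i < Q.length) :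
    StepSpec X D L τ (ρ • S) Q i (forBody L τ sel Q i) := by
  obtain ⟨l₁, q, l₂, rfl, rfl⟩ : ∃ l₁ q l₂, Q = l₁ ++ q :: l₂ ∧ l₁.length = i :=
    ⟨Q.take i, Q[i], Q.drop (i + 1), by simp, by simp [hi.le]⟩
  have hget : (l₁ ++ q :: l₂)[l₁.length]? = some q := by simp
  have hqm : q ∈ l₁ ++ q :: l₂ := by simp
  have hvq := hQ.valid q hqm
  simp only [forBody, hget]
  split_ifs with ha h1 h2 h3
  -- The label was already `included`, so the tree does not change.
  · have e : ({ q with label := Label.included } : Node n) = q := by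
      obtain ⟨-, hl⟩ := ha
      cases q
      simp_all
    rw [e]
    simp only [List.set_append_right _ _ le_rfl, Nat.sub_self, List.set_cons_zero]
    refine StepSpec.refl hQ hi fun p hp _ => ?_
    obtain rfl : q = p := by simpa using hp
    exact Set.inter_eq_left.1 h1
  · simp only [List.set_append_right _ _ le_rfl, Nat.sub_self, List.set_cons_zero]
    refine StepSpec.deactivate hQ ha (fun hc => Label.noConfusion hc.2) hvq fun y hy hyS => ?_
    have : T y ∈ Metric.closedBall q.sample.2 (L * q.radius) ∩ candidate (l₁ ++ q :: l₂) :=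
      ⟨h.map_mem_imageBall hvq hy, hQ.subset (h.map_mem (h.smul_subset hyS))⟩
    rwa [h2] at this
  · exact StepSpec.divide h.τ_pos hsel hQ ha h3
  · simp only [List.set_append_right _ _ le_rfl, Nat.sub_self, List.set_cons_zero]
    refine StepSpec.deactivate hQ ha (fun hc => Label.noConfusion hc.2) hvq fun y hy hyS => ?_
    exact h1 (Set.inter_eq_left.2
      ((h.imageBall_subset hvq (hQ.startable q hqm ha) h3 hy hyS).trans hQ.subset))
  · refine StepSpec.refl hQ hi fun p hp hpa => ?_
    obtain rfl : q = p := by simpa using hp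
    exact absurd hpa ha

/-- Later visits leave earlier nodes alone but may shrink the candidate set, so the tested
inclusions are kept relative to the initial one. The recursion decreases the unvisited nodes plus `2
^ n` times the potential. -/
theorem exists_forLoop_from (h : Setting X T L S lam ρ τ D)
    (hsel : ∀ c, IsNearest D c (sel c)) (Q : List (Node n)) (i : ℕ)
    (hQ : Admissible X D τ (ρ • S) Q) :
    ∃ Q₁, ForLoop L τ sel Q i Q₁ ∧ Admissible X D τ (ρ • S) Q₁ ∧
      candidate Q₁ ⊆ candidate Q ∧ (∀ j < i, Q₁[j]? = Q[j]?) ∧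
      (∀ j, i ≤ j → ∀ q, Q₁[j]? = some q → q.Active → q.imageBall L ⊆ candidate Q) ∧
      (Q₁ = Q ∨ potential τ Q₁ < potential τ Q) := by
  by_cases hi : i < Q.length
  · have hs := stepSpec_forBody h hsel hQ hi
    have hdec := hs.measure_lt
    obtain ⟨Q₁, hloop, hadm, hcand, hpre, hpost, hpot⟩ :=
      exists_forLoop_from h hsel (forBody L τ sel Q i) (i + 1) hs.admissible
    refine ⟨Q₁, .next Q Q₁ i hi hloop, hadm, hcand.trans hs.candidate_subset, ?_, ?_, ?_⟩
    · intro j hj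
      rw [hpre j (by omega), hs.getElem_eq j hj]
    · intro j hj q hq hqa
      rcases hj.eq_or_lt with rfl | hlt
      · exact hs.imageBall_subset q (hpre i (by omega) ▸ hq) hqa
      · exact (hpost j hlt q hq hqa).trans hs.candidate_subset
    · rcases hpot with e | hlt
      · rw [e]
        exact hs.potential_lt
      · rcases hs.potential_lt with e | hlt'
        · exact Or.inr (by rwa [e] at hlt)
        · exact Or.inr (hlt.trans hlt')
  · push Not at hi
    refine ⟨Q, .done Q i hi, hQ, subset_rfl, fun _ _ => rfl, fun j hj q hq => ?_, Or.inl rfl⟩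
    rw [List.getElem?_eq_none (hi.trans hj)] at hq
    cases hq
termination_by Q.length - i + 2 ^ n * potential τ Q

theorem exists_forLoop (h : Setting X T L S lam ρ τ D)
    (hsel : ∀ c, IsNearest D c (sel c)) {Q : List (Node n)}
    (hQ : Admissible X D τ (ρ • S) Q) :
    ∃ Q₁, ForLoop L τ sel Q 0 Q₁ ∧ Admissible X D τ (ρ • S) Q₁ ∧
      candidate Q₁ ⊆ candidate Q ∧ MapsInto L (candidate Q) Q₁ ∧
      (Q₁ = Q ∨ potential τ Q₁ < potential τ Q) := by
  obtain ⟨Q₁, h1, h2, h3, -, h4, h5⟩ := exists_forLoop_from h hsel Q 0 hQ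
  refine ⟨Q₁, h1, h2, h3, fun q hq hqa => ?_, h5⟩
  obtain ⟨j, hj⟩ := List.mem_iff_getElem?.1 hq
  exact h4 j (Nat.zero_le j) q hj hqa

/-- The loop compares sets, not trees, and a pass that only divides keeps the set. Hence `hold`
carries over what the previous pass established. If a pass changes nothing, the next comparison
succeeds; otherwise the potential drops. -/
theorem exists_whileLoop (h : Setting X T L S lam ρ τ D)
    (hsel : ∀ c, IsNearest D c (sel c)) (Q : List (Node n))
    (hQ : Admissible X D τ (ρ • S) Q) (Sold : Set (Fin n → ℝ))
    (hold : candidate Q = Sold → MapsInto L (candidate Q) Q) :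
    ∃ Q', WhileLoop L τ sel (candidate Q) Sold Q Q' (candidate Q') ∧
      Admissible X D τ (ρ • S) Q' ∧ MapsInto L (candidate Q') Q' := by
  by_cases he : candidate Q = Sold
  · exact ⟨Q, .finish _ _ Q he, hQ, hold he⟩
  · obtain ⟨Q₁, hfor, hadm, -, hmaps, hpot⟩ := exists_forLoop h hsel hQ
    rcases hpot with rfl | hlt
    · exact ⟨Q₁, .iter _ _ _ _ _ _ he hfor (.finish _ _ _ rfl), hadm, hmaps⟩
    · obtain ⟨Q', hloop, hadm', hmaps'⟩ :=
        exists_whileLoop h hsel Q₁ hadm (candidate Q) fun e => e ▸ hmaps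
      exact ⟨Q', .iter _ _ _ _ _ _ he hfor hloop, hadm', hmaps'⟩
termination_by potential τ Q

theorem isPI_candidate (h : Setting X T L S lam ρ τ D) {Q : List (Node n)}
    (hQ : ∀ q ∈ Q, q.Valid X D) (hm : MapsInto L (candidate Q) Q) :
    IsPI T (candidate Q) := by
  intro y hy k
  have hmaps : Set.MapsTo T (candidate Q) (candidate Q) := by
    intro w hw
    obtain ⟨q, hq, hqa, hwq⟩ := mem_candidate.1 hw
    exact hm q hq hqa (h.map_mem_imageBall (hQ q hq) hwq)
  exact hmaps.iterate k hy

/-- The first pass is separate because it starts from the sample cover. If the next comparison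
already succeeds, the new candidate set equals that cover, which contains the old candidate set and
thus all image balls. -/
theorem exists_algorithmReturns (h : Setting X T L S lam ρ τ D)
    (hsel : ∀ c, IsNearest D c (sel c)) {Q : List (Node n)}
    (hQ : Admissible X D τ (ρ • S) Q) :
    ∃ Q', AlgorithmReturns L τ sel Q Q' (candidate Q') ∧ IsPI T (candidate Q') ∧
      ρ • S ⊆ candidate Q' := by
  have hcover : candidate Q ⊆ sampleCover Q :=
    candidate_subset_sampleCover fun q hq => (hQ.valid q hq).2.2.2
  -- The loop is entered, since the cover contains the origin.
  have hne : sampleCover Q ≠ ∅ := by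
    have h0 : (0 : Fin n → ℝ) ∈ S := interior_subset h.contractive.2.2.1.2.2
    have h1 := hcover (hQ.subset (Set.smul_mem_smul_set (a := ρ) h0))
    exact Set.Nonempty.ne_empty ⟨_, h1⟩
  obtain ⟨Q₁, hfor, hadm, hsub, hmaps, -⟩ := exists_forLoop h hsel hQ
  obtain ⟨Q', hloop, hadm', hmaps'⟩ :=
    exists_whileLoop h hsel Q₁ hadm (sampleCover Q) fun e q hq hqa =>
      (hmaps q hq hqa).trans (hcover.trans e.ge)
  exact ⟨Q', .iter _ _ _ _ _ _ hne hfor hloop, isPI_candidate h hadm'.valid hmaps',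
    hadm'.subset⟩

/-- Supplies the strict inequality behind the sample bound: `S` contains a cube of side `4 * τ`. -/
theorem IsCSet.pow_lt_volume (hn : 0 < n) (hS : IsCSet S)
    (hτ : 0 < τ) (h : 2 * τ * ubar S ≤ 1) : τ ^ n < volume.real S := by
  have hsub : Metric.closedBall (0 : Fin n → ℝ) (2 * τ) ⊆ S := by
    intro y hy
    rw [← hS.gauge_le_one_iff]
    have := hS.gauge_le_add (Metric.mem_closedBall.1 hy)
    rw [gauge_zero] at this
    linarith
  calc τ ^ n < (2 * (2 * τ)) ^ n := pow_lt_pow_left₀ (by linarith) hτ.le hn.ne'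
    _ = volume.real (Metric.closedBall (0 : Fin n → ℝ) (2 * τ)) := by
        rw [Measure.real, Real.volume_pi_closedBall _ (by positivity),
          ENNReal.toReal_ofReal (by positivity), Fintype.card_fin]
    _ ≤ volume.real S := measureReal_mono hsub hS.2.1.measure_ne_top

end Algorithm

end PISet

/-! ### The probabilistic statement -/

theorem mainTheorem2 {n M : ℕ} (hn : 0 < n)
    -- the system and its Lipschitz bound in the max norm
    (X : Set (Fin n → ℝ)) (hXb : Bornology.IsBounded X) (hXm : MeasurableSet X)
    (T : (Fin n → ℝ) → (Fin n → ℝ)) (L : ℝ) (hL : 0 < L)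
    (hT : ∀ p ∈ X, ∀ q ∈ X, ‖T p - T q‖ ≤ L * ‖p - q‖)
    -- the contractive set
    (S : Set (Fin n → ℝ)) (hSX : S ⊆ X) (lam ρ : ℝ) (hS : PISet.IsContractive T lam S)
    (hlamρ : lam < ρ) (hρ1 : ρ < 1)
    -- minimum radius and confidence level
    (τ δ : ℝ) (hτ : 0 < τ) (hδ : 0 < δ) (hδ1 : δ ≤ 1)
    (hlow : lam + 2 * τ * L * PISet.ubar S ≤ ρ) (hup : ρ ≤ 1 - 2 * τ * PISet.ubar S)
    (hM : (Real.log (1 / δ) + Real.log (volume.real X) + n * Real.log (1 / τ)) /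
        (-Real.log (1 - τ ^ n / volume.real X)) ≤ (M : ℝ))
    -- `M` independent uniform samples from `X`
    {Ω : Type*} [MeasurableSpace Ω] (P : Measure Ω) [IsProbabilityMeasure P]
    (x : Fin M → Ω → (Fin n → ℝ)) (hxm : ∀ j, Measurable (x j))
    (hxind : iIndepFun x P) (hxunif : ∀ j, pdf.IsUniform (x j) X P volume) :
    ∃ E : Set Ω, MeasurableSet E ∧ ENNReal.ofReal (1 - δ) ≤ P E ∧
      ∀ ω ∈ E, ∀ D : Fin M → (Fin n → ℝ) × (Fin n → ℝ), (∀ j, D j = (x j ω, T (x j ω))) →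
        ∀ Q : List (PISet.Node n), PISet.IsTree X D Q →
          (∀ q ∈ Q, q.Active → q.Startable D τ) → ρ • S ⊆ PISet.candidate Q →
        ∀ sel : (Fin n → ℝ) → (Fin n → ℝ) × (Fin n → ℝ), (∀ c, PISet.IsNearest D c (sel c)) →
          ∃ (Q' : List (PISet.Node n)) (O : Set (Fin n → ℝ)),
            PISet.AlgorithmReturns L τ sel Q Q' O ∧ O = PISet.candidate Q' ∧
              PISet.IsPI T O ∧ ρ • S ⊆ O := by
  have hV : volume X ≠ ⊤ := hXb.measure_lt_top.ne
  have hC := hS.2.2.1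
  have hρ0 : 0 ≤ ρ := hS.1.trans hlamρ.le
  have hvol : τ ^ n < volume.real X :=
    (hC.pow_lt_volume hn hτ (by linarith)).trans_le (measureReal_mono hSX hV)
  obtain ⟨E, hE, hPE, hdense⟩ :=
    PISet.exists_event_samples_dense hV hXm hτ hδ hvol hM hxm hxind hxunif
  refine ⟨E, hE, hPE, fun ω hω D hD Q hQ hst hsub sel hsel => ?_⟩
  obtain ⟨hX, hd⟩ := hdense ω hω
  have hset : PISet.Setting X T L S lam ρ τ D :=
    { L_pos := hL
      lipschitz := hT
      subset := hSX
      contractive := hS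
      lam_lt := hlamρ
      τ_pos := hτ
      low := hlow
      up := hup
      data := fun j => by simpa [hD j] using hX j
      dense := fun c hc => by simpa [hD] using hd c hc }
  obtain ⟨Q', h1, h2, h3⟩ := PISet.exists_algorithmReturns hset hsel ⟨hQ, hst, hsub⟩
  exact ⟨Q', _, h1, rfl, h2, h3⟩
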